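/- Let $\mathcal A$ be an abelian category. A filtered object of $\mathcal A$ is an object $X$ with a decreasing filtration $(F^pX)_{p\in\mathbb Z}$ by subobjects; a morphism of filtered objects is a morphism $f$ with $f(F^p)\subseteq F^p$ for all $p$. Fix one of the following two conditions on filtrations: (i) finite: $F^aX=X$ and $F^bX=0$ for some integers $a,b$; (ii) regular and exhaustive: $F^qX=0$ for some integer $q$, and $X$ is the union of the $F^pX$, stably under pullback, i.e. for every morphism $f:T\to X$ the least upper bound of the subobjects $f^{-1}(F^pX)$, $p\in\mathbb Z$, is $T$. (If $\mathcal A$ has exact sequential unions, for instance if $\mathcal A$ satisfies AB5, the last condition just means $X=\bigcup_pF^pX$.) Fix also a boundedness condition $\#\in\{\emptyset,+,-,b\}$ (unbounded, bounded below, bounded above, bounded), and let $\mathbf C^{\#}(\mathbf F\mathcal A)$ be the category of $\mathbb Z$-graded cochain complexes $K$ of filtered objects whose filtration satisfies the chosen condition in each degree and which satisfy the boundedness condition $\#$. Let $E_r(K)$, $r\ge 0$, be the spectral sequence of $K$: $$E_r^{p,n-p}(K)=Z_r^pK^n\big/\big(Z_{r-1}^{p+1}K^n+dZ_{r-1}^{p-r+1}K^{n-1}\big),\qquad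 Z_s^pK^n=F^pK^n\cap d^{-1}(F^{p+s}K^{n+1}),$$ with the differential $d_r$ induced by $d$. Let $\mathcal E_r$ be the class of morphisms $f$ of $\mathbf C^{\#}(\mathbf F\mathcal A)$ such that $E_r(f)$ is a quasi-isomorphism of the complexes $(E_r,d_r)$, and let $\mathbf D_r^{\#}(\mathbf F\mathcal A)=\mathbf C^{\#}(\mathbf F\mathcal A)[\mathcal E_r^{-1}]$ be the $r$-derived category. Let $\mathrm{Dec}:\mathbf C^{\#}(\mathbf F\mathcal A)\to\mathbf C^{\#}(\mathbf F\mathcal A)$ be Deligne's décalage functor, which is the identity on underlying complexes and morphisms and replaces $F$ by $$(\mathrm{Dec}F)^pK^n=F^{p+n}K^n\cap d^{-1}(F^{p+n+1}K^{n+1}).$$ **Theorem.** For every integer $r\ge 0$, one has $\mathrm{Dec}(\mathcal E_{r+1})\subseteq\mathcal E_r$, and the functor induced by $\mathrm{Dec}$ on localizations is an equivalence of categories $$\mathrm{Dec}:\mathbf D_{r+1}^{\#}(\mathbf F\mathcal A)\xrightarrow{\ \sim\ }\mathbf D_r^{\#}(\mathbf F\mathcal A).$$ -/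

import Mathlib

open CategoryTheory CategoryTheory.Limits

universe v u

namespace FilteredDecalage

section Subobjects

variable {A : Type u} [Category.{v} A] [Abelian A]

/-- The subobject `f⁻¹(G)` of `X`, for `f : X ⟶ Y` and a subobject `G` of `Y`. -/
noncomputable abbrev preimage {X Y : A} (f : X ⟶ Y) (G : Subobject Y) : Subobject X :=
  (Subobject.pullback f).obj G

/-- The subobject `f(G)` of `Y`, for `f : X ⟶ Y` and a subobject `G` of `X`. -/
noncomputable abbrev directImage {X Y : A} (f : X ⟶ Y) (G : Subobject X) : Subobject Y :=
  imageSubobject (G.arrow ≫ f)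

theorem preimage_mono {X Y : A} (f : X ⟶ Y) {G G' : Subobject Y} (h : G ≤ G') :
    preimage f G ≤ preimage f G' :=
  (Subobject.pullback f).monotone h

theorem le_preimage_iff {X Y : A} (f : X ⟶ Y) (G : Subobject X) (H : Subobject Y) :
    G ≤ preimage f H ↔ H.Factors (G.arrow ≫ f) := by
  constructor
  · intro h
    rw [Subobject.factors_iff]
    refine ⟨Subobject.ofLE _ _ h ≫ Subobject.pullbackπ f H, ?_⟩
    change (Subobject.ofLE _ _ h ≫ Subobject.pullbackπ f H) ≫ H.arrow = _
    rw [Category.assoc, (Subobject.isPullback f H).w, Subobject.ofLE_arrow_assoc]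
  · intro h
    refine Subobject.le_of_comm
      ((Subobject.isPullback f H).lift (H.factorThru _ h) G.arrow (by simp)) ?_
    simp

theorem directImage_le_iff {X Y : A} (f : X ⟶ Y) (G : Subobject X) (H : Subobject Y) :
    directImage f G ≤ H ↔ G ≤ preimage f H := by
  rw [le_preimage_iff]
  constructor
  · intro h
    refine Subobject.factors_of_le _ h ?_
    simpa using imageSubobject_factors_comp_self (G.arrow ≫ f) (𝟙 _)
  · intro h
    exact imageSubobject_le _ (H.factorThru _ h) (by simp)

theorem preimage_comp {X Y W : A} (f : X ⟶ Y) (g : Y ⟶ W) (G : Subobject W) :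
    preimage (f ≫ g) G = preimage f (preimage g G) :=
  Subobject.pullback_comp f g G

theorem preimage_inf {X Y : A} (f : X ⟶ Y) (G H : Subobject Y) :
    preimage f (G ⊓ H) = preimage f G ⊓ preimage f H :=
  Subobject.inf_pullback f G H

theorem preimage_zero {X Y : A} (H : Subobject Y) : preimage (0 : X ⟶ Y) H = ⊤ := by
  rw [eq_top_iff, le_preimage_iff, comp_zero]
  exact Subobject.factors_zero

/-- The morphism `G ⟶ H` induced by `f : X ⟶ Y`, when `f(G) ⊆ H`. -/
noncomputable def restrict {X Y : A} (f : X ⟶ Y) {G : Subobject X} {H : Subobject Y}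
    (h : G ≤ preimage f H) : (G : A) ⟶ (H : A) :=
  H.factorThru (G.arrow ≫ f) ((le_preimage_iff f G H).1 h)

@[simp]
theorem restrict_arrow {X Y : A} (f : X ⟶ Y) {G : Subobject X} {H : Subobject Y}
    (h : G ≤ preimage f H) : restrict f h ≫ H.arrow = G.arrow ≫ f := by
  simp [restrict]

/-- The quotient `Z / B` of two nested subobjects `B ≤ Z`. -/
noncomputable def subquotient {X : A} {B Z : Subobject X} (h : B ≤ Z) : A :=
  cokernel (Subobject.ofLE B Z h)

/-- The morphism `Z / B ⟶ Z' / B'` induced by `f : X ⟶ Y`, when `f(Z) ⊆ Z'` and `f(B) ⊆ B'`. -/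
noncomputable def subquotientMap {X Y : A} {B Z : Subobject X} {B' Z' : Subobject Y}
    (h : B ≤ Z) (h' : B' ≤ Z') (f : X ⟶ Y)
    (hZ : Z ≤ preimage f Z') (hB : B ≤ preimage f B') :
    subquotient h ⟶ subquotient h' :=
  cokernel.map _ _ (restrict f hB) (restrict f hZ) (by
    rw [← cancel_mono Z'.arrow]
    simp)

/-- The projection `Z ⟶ Z / B`. -/
noncomputable def subquotientπ {X : A} {B Z : Subobject X} (h : B ≤ Z) :
    (Z : A) ⟶ subquotient h :=
  cokernel.π (Subobject.ofLE B Z h)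

theorem subquotientπ_map {X Y : A} {B Z : Subobject X} {B' Z' : Subobject Y}
    (h : B ≤ Z) (h' : B' ≤ Z') (f : X ⟶ Y)
    (hZ : Z ≤ preimage f Z') (hB : B ≤ preimage f B') :
    subquotientπ h ≫ subquotientMap h h' f hZ hB = restrict f hZ ≫ subquotientπ h' :=
  cokernel.π_desc _ _ _

theorem subquotient_ext {X : A} {B Z : Subobject X} {h : B ≤ Z} {W : A}
    {f g : subquotient h ⟶ W} (hfg : subquotientπ h ≫ f = subquotientπ h ≫ g) : f = g :=
  coequalizer.hom_ext hfg

theorem subquotientMap_id {X : A} {B Z : Subobject X} (h : B ≤ Z)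
    (hZ : Z ≤ preimage (𝟙 X) Z) (hB : B ≤ preimage (𝟙 X) B) :
    subquotientMap h h (𝟙 X) hZ hB = 𝟙 _ := by
  have : restrict (𝟙 X) hZ = 𝟙 _ := by
    rw [← cancel_mono Z.arrow]
    simp
  apply subquotient_ext
  rw [subquotientπ_map, this, Category.id_comp, Category.comp_id]

theorem subquotientMap_comp {X Y W : A} {B Z : Subobject X} {B' Z' : Subobject Y}
    {B'' Z'' : Subobject W} (h : B ≤ Z) (h' : B' ≤ Z') (h'' : B'' ≤ Z'')
    (f : X ⟶ Y) (g : Y ⟶ W) (k : X ⟶ W) (hk : f ≫ g = k)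
    (hZ : Z ≤ preimage f Z') (hB : B ≤ preimage f B')
    (gZ : Z' ≤ preimage g Z'') (gB : B' ≤ preimage g B'')
    (kZ : Z ≤ preimage k Z'') (kB : B ≤ preimage k B'') :
    subquotientMap h h' f hZ hB ≫ subquotientMap h' h'' g gZ gB =
      subquotientMap h h'' k kZ kB := by
  subst hk
  have : restrict f hZ ≫ restrict g gZ = restrict (f ≫ g) kZ := by
    rw [← cancel_mono Z''.arrow, Category.assoc, restrict_arrow, restrict_arrow,
      ← Category.assoc, restrict_arrow, Category.assoc]
  apply subquotient_ext
  rw [← Category.assoc, subquotientπ_map, Category.assoc, subquotientπ_map,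
    ← Category.assoc, this, subquotientπ_map]

theorem subquotientMap_zero {X Y : A} {B Z : Subobject X} {B' Z' : Subobject Y}
    (h : B ≤ Z) (h' : B' ≤ Z') (f : X ⟶ Y) (hf : f = 0)
    (hZ : Z ≤ preimage f Z') (hB : B ≤ preimage f B') :
    subquotientMap h h' f hZ hB = 0 := by
  subst hf
  have : restrict (0 : X ⟶ Y) hZ = 0 := by
    rw [← cancel_mono Z'.arrow, restrict_arrow, comp_zero, zero_comp]
  apply subquotient_ext
  rw [subquotientπ_map, this, zero_comp, comp_zero]

end Subobjects

/-! ### Filtered objects and filtered complexes -/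

/-- An object of `A` with a decreasing filtration by subobjects indexed by `ℤ`. -/
structure FilteredObject (A : Type u) [Category.{v} A] where
  /-- the underlying object -/
  obj : A
  /-- the filtration `F^p` -/
  F : ℤ → Subobject obj
  anti : Antitone F

section Filtered

variable {A : Type u} [Category.{v} A] [Abelian A]

namespace FilteredObject

/-- A morphism of filtered objects: a morphism `f` with `f(F^p X) ⊆ F^p Y` for all `p`. -/
@[ext]
structure Hom (X Y : FilteredObject A) where
  /-- the underlying morphism -/
  hom : X.obj ⟶ Y.obj
  map_le : ∀ p : ℤ, X.F p ≤ preimage hom (Y.F p)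

instance : Category (FilteredObject A) where
  Hom := Hom
  id X := ⟨𝟙 _, fun p => by rw [preimage, Subobject.pullback_id]⟩
  comp f g := ⟨f.hom ≫ g.hom, fun p => by
    rw [preimage, Subobject.pullback_comp]
    exact (f.map_le p).trans (preimage_mono _ (g.map_le p))⟩

@[ext]
theorem hom_ext {X Y : FilteredObject A} {f g : X ⟶ Y} (h : f.hom = g.hom) : f = g :=
  Hom.ext h

@[simp]
theorem id_hom (X : FilteredObject A) : Hom.hom (𝟙 X) = 𝟙 X.obj := rfl

@[simp]
theorem comp_hom {X Y W : FilteredObject A} (f : X ⟶ Y) (g : Y ⟶ W) :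
    Hom.hom (f ≫ g) = f.hom ≫ g.hom := rfl

instance {X Y : FilteredObject A} : Zero (X ⟶ Y) :=
  ⟨⟨0, fun p => by rw [preimage_zero]; exact le_top⟩⟩

@[simp]
theorem zero_hom {X Y : FilteredObject A} : Hom.hom (0 : X ⟶ Y) = 0 := rfl

instance : HasZeroMorphisms (FilteredObject A) where
  comp_zero f Z := by ext; simp
  zero_comp X {Y Z} f := by ext; simp

/-- The filtration is finite: `F^a X = X` and `F^b X = 0` for some `a` and `b`. -/
def IsFinite (X : FilteredObject A) : Prop :=
  (∃ a : ℤ, X.F a = ⊤) ∧ ∃ b : ℤ, X.F b = ⊥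

/-- The filtration is regular: `F^q X = 0` for some `q`. -/
def IsRegular (X : FilteredObject A) : Prop :=
  ∃ q : ℤ, X.F q = ⊥

/-- The filtration is exhaustive: `X` is the union of the `F^p X`, the union being stable under
pullback along every morphism `f : T ⟶ X` (in particular along `𝟙 X`), that is,
`T = ⋃ p, f⁻¹(F^p X)`. For abelian categories with exact sequential unions this
just means `X = ⋃ p, F^p X`, see `isExhaustive_iff`. -/
def IsExhaustive (X : FilteredObject A) : Prop :=
  ∀ (T : A) (f : T ⟶ X.obj), IsLUB (Set.range fun p : ℤ => preimage f (X.F p)) ⊤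

end FilteredObject

/-- The category of (unbounded) filtered complexes: cochain complexes of filtered objects. -/
abbrev FilteredComplex (A : Type u) [Category.{v} A] [Abelian A] :=
  CochainComplex (FilteredObject A) ℤ

namespace FilteredComplex

/-- The differential of the underlying complex of a filtered complex. -/
abbrev diff (K : FilteredComplex A) (m n : ℤ) : (K.X m).obj ⟶ (K.X n).obj :=
  (K.d m n).hom

theorem diff_comp (K : FilteredComplex A) (l m n : ℤ) : K.diff l m ≫ K.diff m n = 0 :=
  congrArg FilteredObject.Hom.hom (K.d_comp_d l m n)

theorem diff_shape (K : FilteredComplex A) (m n : ℤ) (h : ¬ m + 1 = n) : K.diff m n = 0 :=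
  congrArg FilteredObject.Hom.hom (K.shape m n h)

theorem comm {K L : FilteredComplex A} (f : K ⟶ L) (m n : ℤ) :
    (f.f m).hom ≫ L.diff m n = K.diff m n ≫ (f.f n).hom :=
  congrArg FilteredObject.Hom.hom (f.comm m n)

/-! ### The spectral sequence -/

/-- `Z_s^p K^n = F^p K^n ∩ d⁻¹(F^{p+s} K^{n+1})`. -/
noncomputable def Z (K : FilteredComplex A) (s p n : ℤ) : Subobject (K.X n).obj :=
  (K.X n).F p ⊓ preimage (K.diff n (n + 1)) ((K.X (n + 1)).F (p + s))

/-- `B_s^p K^n = Z_{s-1}^{p+1} K^n + d(Z_{s-1}^{p-s+1} K^{n-1})`, so that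
`E_s^{p,n-p}(K) = Z_s^p K^n / B_s^p K^n`. -/
noncomputable def B (K : FilteredComplex A) (s p n : ℤ) : Subobject (K.X n).obj :=
  K.Z (s - 1) (p + 1) n ⊔ directImage (K.diff (n - 1) n) (K.Z (s - 1) (p - s + 1) (n - 1))

theorem Z_le_preimage_diff (K : FilteredComplex A) (s p n n' : ℤ) (h : n + 1 = n') (t : ℤ) :
    K.Z s p n ≤ preimage (K.diff n n') (K.Z t (p + s) n') := by
  subst h
  have h1 : preimage (K.diff n (n + 1)) (preimage (K.diff (n + 1) (n + 1 + 1))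
      ((K.X (n + 1 + 1)).F (p + s + t))) = ⊤ := by
    rw [← preimage_comp, diff_comp]
    exact preimage_zero _
  rw [Z, Z, preimage_inf]
  exact le_inf inf_le_right (h1 ▸ le_top)

theorem Z_mono (K : FilteredComplex A) {s p s' p' : ℤ} (n : ℤ) (hp : p' ≤ p)
    (hs : p' + s' ≤ p + s) : K.Z s p n ≤ K.Z s' p' n :=
  inf_le_inf ((K.X n).anti hp) (preimage_mono _ ((K.X (n + 1)).anti hs))

theorem B_le_Z (K : FilteredComplex A) (r : ℕ) (p n : ℤ) : K.B r p n ≤ K.Z r p n := by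
  refine sup_le (K.Z_mono n (by lia) (by lia)) ?_
  rw [directImage_le_iff]
  refine (K.Z_le_preimage_diff _ _ _ n (by lia) r).trans (preimage_mono _ ?_)
  exact K.Z_mono n (by lia) (by lia)

theorem B_le_preimage_diff (K : FilteredComplex A) (r : ℕ) (p n n' : ℤ) (h : n + 1 = n') :
    K.B r p n ≤ preimage (K.diff n n') (K.B r (p + r) n') := by
  refine sup_le ?_ ?_
  · subst h
    rw [← directImage_le_iff]
    refine le_trans ?_ le_sup_right
    have aux : ∀ (m : ℤ) (_ : m = n) (p' : ℤ) (_ : p' = p + 1),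
        directImage (K.diff n (n + 1)) (K.Z (r - 1) (p + 1) n) ≤
          directImage (K.diff m (n + 1)) (K.Z (r - 1) p' m) := by
      rintro _ rfl _ rfl
      exact le_rfl
    exact aux _ (by lia) _ (by lia)
  · rw [directImage_le_iff, ← preimage_comp, diff_comp]
    exact le_top.trans_eq (preimage_zero _).symm

theorem Z_le_preimage {K L : FilteredComplex A} (f : K ⟶ L) (s p n : ℤ) :
    K.Z s p n ≤ preimage (f.f n).hom (L.Z s p n) := by
  rw [Z, Z, preimage_inf]
  refine inf_le_inf ((f.f n).map_le p) ?_
  rw [← preimage_comp, comm, preimage_comp]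
  exact preimage_mono _ ((f.f (n + 1)).map_le _)

theorem B_le_preimage {K L : FilteredComplex A} (f : K ⟶ L) (s p n : ℤ) :
    K.B s p n ≤ preimage (f.f n).hom (L.B s p n) := by
  refine sup_le ((Z_le_preimage f _ _ _).trans (preimage_mono _ le_sup_left)) ?_
  rw [directImage_le_iff, ← preimage_comp, ← comm, preimage_comp]
  refine (Z_le_preimage f _ _ _).trans (preimage_mono _ ?_)
  exact ((directImage_le_iff _ _ _).1 le_rfl).trans (preimage_mono _ le_sup_right)

/-- The `r`-th page of the spectral sequence of a filtered complex, with differential `d_r`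
induced by `d`. The term with index `(p, n)` is
`E_r^{p,n-p} = Z_r^p K^n / (Z_{r-1}^{p+1} K^n + d(Z_{r-1}^{p-r+1} K^{n-1}))`,
so that in these indices `d_r` has degree `(r, 1)`. -/
noncomputable def page (K : FilteredComplex A) (r : ℕ) :
    HomologicalComplex A (ComplexShape.up' ((r, 1) : ℤ × ℤ)) where
  X i := subquotient (K.B_le_Z r i.1 i.2)
  d i j :=
    if h : i.1 + r = j.1 ∧ i.2 + 1 = j.2 then
      subquotientMap _ _ (K.diff i.2 j.2)
        (h.1 ▸ K.Z_le_preimage_diff r i.1 i.2 j.2 h.2 r)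
        (h.1 ▸ K.B_le_preimage_diff r i.1 i.2 j.2 h.2)
    else 0
  shape i j h := by
    rw [dif_neg]
    rintro ⟨h1, h2⟩
    exact h (Prod.ext h1 h2)
  d_comp_d' i j k hij hjk := by
    subst hij hjk
    rw [dif_pos ⟨rfl, rfl⟩, dif_pos ⟨rfl, rfl⟩,
      subquotientMap_comp _ _ _ _ _ 0 (K.diff_comp _ _ _) _ _ _ _
        (by rw [preimage_zero]; exact le_top) (by rw [preimage_zero]; exact le_top)]
    exact subquotientMap_zero _ _ _ rfl _ _

theorem page_d (K : FilteredComplex A) (r : ℕ) (p n : ℤ) :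
    (K.page r).d (p, n) (p + r, n + 1) =
      subquotientMap (K.B_le_Z r p n) (K.B_le_Z r (p + r) (n + 1)) (K.diff n (n + 1))
        (K.Z_le_preimage_diff r p n (n + 1) rfl r) (K.B_le_preimage_diff r p n (n + 1) rfl) :=
  dif_pos ⟨rfl, rfl⟩

/-- The morphism `E_r(f) : E_r(K) ⟶ E_r(L)` induced by a morphism of filtered complexes. -/
noncomputable def pageMap {K L : FilteredComplex A} (f : K ⟶ L) (r : ℕ) :
    K.page r ⟶ L.page r where
  f i := subquotientMap _ _ (f.f i.2).hom (Z_le_preimage f r i.1 i.2) (B_le_preimage f r i.1 i.2)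
  comm' i j hij := by
    subst hij
    have hZ := (K.Z_le_preimage_diff r i.1 i.2 (i.2 + 1) rfl r).trans
      (preimage_mono _ (Z_le_preimage f r (i.1 + r) (i.2 + 1)))
    have hB := (K.B_le_preimage_diff r i.1 i.2 (i.2 + 1) rfl).trans
      (preimage_mono _ (B_le_preimage f r (i.1 + r) (i.2 + 1)))
    rw [← preimage_comp] at hZ hB
    exact (congrArg _ (L.page_d r i.1 i.2)).trans ((subquotientMap_comp _ _ _ _ _ _
      (comm f i.2 (i.2 + 1)) _ _ _ _ hZ hB).trans (((congrArg (· ≫ _)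
      (K.page_d r i.1 i.2)).trans (subquotientMap_comp _ _ _ _ _ _ rfl _ _ _ _ hZ hB)).symm))

/-- The functor sending a filtered complex to the `r`-th page of its spectral sequence. -/
noncomputable def pageFunctor (A : Type u) [Category.{v} A] [Abelian A] (r : ℕ) :
    FilteredComplex A ⥤ HomologicalComplex A (ComplexShape.up' ((r, 1) : ℤ × ℤ)) where
  obj K := K.page r
  map f := pageMap f r
  map_id K := by
    apply HomologicalComplex.Hom.ext
    funext i
    exact subquotientMap_id _ (Z_le_preimage (𝟙 K) r _ _) (B_le_preimage (𝟙 K) r _ _)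
  map_comp f g := by
    apply HomologicalComplex.Hom.ext
    funext i
    exact (subquotientMap_comp _ _ _ _ _ _ rfl
      (Z_le_preimage f r _ _) (B_le_preimage f r _ _)
      (Z_le_preimage g r _ _) (B_le_preimage g r _ _)
      (Z_le_preimage (f ≫ g) r _ _) (B_le_preimage (f ≫ g) r _ _)).symm

/-- The class of `E_r`-quasi-isomorphisms: the morphisms `f` such that `E_r(f)` is a
quasi-isomorphism. -/
def EQuasiIso (A : Type u) [Category.{v} A] [Abelian A] (r : ℕ) :
    MorphismProperty (FilteredComplex A) :=
  fun _ _ f => QuasiIso ((pageFunctor A r).map f)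

/-! ### Deligne's décalage -/

/-- `(Dec F)^p K^n = F^{p+n} K^n ∩ d⁻¹(F^{p+n+1} K^{n+1})`. -/
noncomputable def decF (K : FilteredComplex A) (n p : ℤ) : Subobject (K.X n).obj :=
  (K.X n).F (p + n) ⊓ preimage (K.diff n (n + 1)) ((K.X (n + 1)).F (p + n + 1))

theorem decF_antitone (K : FilteredComplex A) (n : ℤ) : Antitone (K.decF n) := fun _ _ h =>
  inf_le_inf ((K.X n).anti (by lia)) (preimage_mono _ ((K.X (n + 1)).anti (by lia)))

theorem decF_le_diff (K : FilteredComplex A) (m n p : ℤ) :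
    K.decF m p ≤ preimage (K.diff m n) (K.decF n p) := by
  by_cases h : m + 1 = n
  · subst h
    rw [decF, decF, preimage_inf, ← preimage_comp, diff_comp, preimage_zero, inf_top_eq]
    exact inf_le_right.trans (preimage_mono _ ((K.X (m + 1)).anti (by lia)))
  · rw [K.diff_shape m n h, preimage_zero]
    exact le_top

theorem decF_le_map {K L : FilteredComplex A} (f : K ⟶ L) (n p : ℤ) :
    K.decF n p ≤ preimage (f.f n).hom (L.decF n p) := by
  rw [decF, decF, preimage_inf, ← preimage_comp, comm, preimage_comp]
  exact inf_le_inf ((f.f n).map_le _) (preimage_mono _ ((f.f (n + 1)).map_le _))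

/-- The décalage of a filtered complex: same underlying complex, with filtration `Dec F`. -/
noncomputable def dec (K : FilteredComplex A) : FilteredComplex A where
  X n := ⟨(K.X n).obj, K.decF n, K.decF_antitone n⟩
  d m n := ⟨K.diff m n, K.decF_le_diff m n⟩
  shape m n h := FilteredObject.hom_ext (K.diff_shape m n h)
  d_comp_d' l m n _ _ := FilteredObject.hom_ext (K.diff_comp l m n)

/-- The décalage functor, the identity on morphisms. -/
noncomputable def decFunctor (A : Type u) [Category.{v} A] [Abelian A] :
    FilteredComplex A ⥤ FilteredComplex A where
  obj K := K.dec
  map f :=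
    { f n := ⟨(f.f n).hom, decF_le_map f n⟩
      comm' m n _ := FilteredObject.hom_ext (comm f m n) }
  map_id _ := rfl
  map_comp _ _ := rfl

end FilteredComplex

/-! ### Boundedness and finiteness conditions -/

/-- The possible boundedness conditions on complexes. -/
inductive Boundedness
  | unbounded
  | below
  | above
  | bounded

/-- The property of complexes corresponding to a boundedness condition. -/
def Boundedness.Holds (K : FilteredComplex A) : Boundedness → Prop
  | unbounded => True
  | below => ∃ a : ℤ, ∀ n < a, IsZero (K.X n)
  | above => ∃ b : ℤ, ∀ n > b, IsZero (K.X n)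
  | bounded => (∃ a : ℤ, ∀ n < a, IsZero (K.X n)) ∧ ∃ b : ℤ, ∀ n > b, IsZero (K.X n)

/-- The two standard conditions imposed on filtrations. -/
inductive FiltrationType
  | finite
  | regularExhaustive

/-- The property of filtered objects corresponding to a condition on filtrations. -/
def FiltrationType.Holds (X : FilteredObject A) : FiltrationType → Prop
  | finite => X.IsFinite
  | regularExhaustive => X.IsRegular ∧ X.IsExhaustive

namespace FilteredObject

theorem isZero_iff (X : FilteredObject A) : IsZero X ↔ IsZero X.obj := by
  rw [IsZero.iff_id_eq_zero, IsZero.iff_id_eq_zero]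
  exact ⟨fun h => congrArg Hom.hom h, fun h => hom_ext h⟩

/-- A finite filtration is regular and exhaustive. -/
theorem IsFinite.isExhaustive {X : FilteredObject A} (h : X.IsFinite) : X.IsExhaustive := by
  obtain ⟨⟨a, ha⟩, -⟩ := h
  refine fun T f => ⟨fun _ _ => le_top, fun U hU => ?_⟩
  have : preimage f (X.F a) ≤ U := hU ⟨a, rfl⟩
  rwa [ha, preimage, Subobject.pullback_top] at this

end FilteredObject

namespace FilteredComplex

theorem dec_isRegular (K : FilteredComplex A) (n : ℤ) (h : (K.X n).IsRegular) :
    (K.dec.X n).IsRegular := by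
  obtain ⟨q, hq⟩ := h
  have : K.decF n (q - n) ≤ (K.X n).F q := inf_le_left.trans ((K.X n).anti (by lia))
  exact ⟨q - n, le_bot_iff.1 (this.trans_eq hq)⟩

theorem dec_isFinite (K : FilteredComplex A) (n : ℤ) (h : (K.X n).IsFinite)
    (h' : (K.X (n + 1)).IsFinite) : (K.dec.X n).IsFinite := by
  refine ⟨?_, K.dec_isRegular n h.2⟩
  obtain ⟨⟨a, ha⟩, -⟩ := h
  obtain ⟨⟨b, hb⟩, -⟩ := h'
  refine ⟨min a b - n - 1, top_le_iff.1 (le_inf ?_ ?_)⟩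
  · exact ha.symm.le.trans ((K.X n).anti (by lia))
  · refine (Subobject.pullback_top (K.diff n (n + 1))).symm.le.trans (preimage_mono _ ?_)
    exact hb.symm.le.trans ((K.X (n + 1)).anti (by lia))

theorem decF_exhaustive (K : FilteredComplex A) (n : ℤ) (h : (K.X n).IsExhaustive)
    (h' : (K.X (n + 1)).IsExhaustive) {T : A} (f : T ⟶ (K.X n).obj) (U : Subobject T)
    (hU : ∀ p, preimage f (K.decF n p) ≤ U) : ⊤ ≤ U := by
  refine (h T f).2 ?_
  rintro _ ⟨p, rfl⟩
  let P : Subobject T := preimage f ((K.X n).F p)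
  have key : ⊤ ≤ preimage P.arrow U := by
    refine (h' _ (P.arrow ≫ f ≫ K.diff n (n + 1))).2 ?_
    rintro _ ⟨q, rfl⟩
    have hm := hU (min p (q - 1) - n)
    refine le_trans ?_ (preimage_mono _ hm)
    rw [decF, preimage_inf, preimage_inf]
    refine le_inf (le_top.trans ?_) ?_
    · have h1 : P ≤ preimage f ((K.X n).F (min p (q - 1) - n + n)) :=
        preimage_mono f ((K.X n).anti (by lia))
      refine le_trans ?_ (preimage_mono _ h1)
      rw [le_preimage_iff]
      exact Subobject.factors_of_factors_right _ (P.factors_self)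
    · rw [← preimage_comp, ← preimage_comp, Category.assoc]
      exact preimage_mono _ ((K.X (n + 1)).anti (by lia))
  rw [le_preimage_iff] at key
  have h2 : U.Factors P.arrow := by
    have := Subobject.factors_of_factors_right (P := U) (inv (⊤ : Subobject (P : A)).arrow) key
    simpa using this
  exact Subobject.le_of_factors h2

theorem dec_isExhaustive (K : FilteredComplex A) (n : ℤ) (h : (K.X n).IsExhaustive)
    (h' : (K.X (n + 1)).IsExhaustive) : (K.dec.X n).IsExhaustive := fun _ f =>
  ⟨fun _ _ => le_top, fun U hU => K.decF_exhaustive n h h' f U fun p => hU ⟨p, rfl⟩⟩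

theorem dec_filtration (K : FilteredComplex A) (κ : FiltrationType)
    (h : ∀ n, κ.Holds (K.X n)) (n : ℤ) : κ.Holds (K.dec.X n) := by
  cases κ with
  | finite => exact K.dec_isFinite n (h n) (h (n + 1))
  | regularExhaustive =>
    exact ⟨K.dec_isRegular n (h n).1, K.dec_isExhaustive n (h n).2 (h (n + 1)).2⟩

theorem dec_bounded (K : FilteredComplex A) (b : Boundedness) (h : b.Holds K) :
    b.Holds K.dec := by
  have key : ∀ n, IsZero (K.X n) → IsZero (K.dec.X n) := fun n hn =>
    (FilteredObject.isZero_iff (K.dec.X n)).2 ((FilteredObject.isZero_iff (K.X n)).1 hn)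
  cases b with
  | unbounded => trivial
  | below => exact h.imp fun a ha n hn => key n (ha n hn)
  | above => exact h.imp fun a ha n hn => key n (ha n hn)
  | bounded =>
    exact ⟨h.1.imp fun a ha n hn => key n (ha n hn), h.2.imp fun a ha n hn => key n (ha n hn)⟩

end FilteredComplex

namespace FilteredObject

/-- In an abelian category with exact sequential unions (for instance one satisfying AB5), the
filtration of `X` is exhaustive if and only if `X` is the union of the `F^p X`. -/
theorem isExhaustive_iff [HasColimitsOfShape ℤ A] [HasExactColimitsOfShape ℤ A]
    (X : FilteredObject A) : X.IsExhaustive ↔ IsLUB (Set.range X.F) ⊤ := by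
  constructor
  · intro h
    have := h _ (𝟙 X.obj)
    simpa only [preimage, Subobject.pullback_id] using this
  intro h T f
  refine ⟨fun _ _ => le_top, fun U hU => ?_⟩
  have := IsFiltered.isConnected ℤ
  let G : ℤ ⥤ A :=
    { obj j := (X.F (-j) : A)
      map {i j} k := Subobject.ofLE _ _ (X.anti (neg_le_neg (leOfHom k))) }
  let Ψ : G ⟶ (Functor.const ℤ).obj X.obj :=
    { app j := (X.F (-j)).arrow
      naturality i j k := by simp [G] }
  have : Mono Ψ := by
    have : ∀ j, Mono (Ψ.app j) := fun j => inferInstanceAs (Mono (X.F (-j)).arrow)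
    exact NatTrans.mono_of_mono_app Ψ
  let e (Y : A) : colim.obj ((Functor.const ℤ).obj Y) ⟶ Y :=
    ((colimit.isColimit _).coconePointUniqueUpToIso (isColimitConstCocone ℤ Y)).hom
  have he (Y : A) (j : ℤ) : colimit.ι ((Functor.const ℤ).obj Y) j ≫ e Y = 𝟙 Y :=
    (colimit.isColimit _).comp_coconePointUniqueUpToIso_hom (isColimitConstCocone ℤ Y) j
  have (Y : A) : IsIso (e Y) := Iso.isIso_hom
    ((colimit.isColimit ((Functor.const ℤ).obj Y)).coconePointUniqueUpToIso
      (isColimitConstCocone ℤ Y))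
  have key {Q : ℤ ⥤ A} (α : Q ⟶ (Functor.const ℤ).obj T) (j : ℤ) :
      colimit.ι Q j ≫ colim.map α ≫ e T = α.app j := by
    have := ι_colimMap_assoc α j (e T)
    refine this.trans ?_
    rw [he]
    exact Category.comp_id _
  have hΨ : IsIso (colim.map Ψ) := by
    have hm (j : ℤ) : colimit.ι G j ≫ colim.map Ψ ≫ e X.obj = (X.F (-j)).arrow := by
      refine (ι_colimMap_assoc Ψ j (e X.obj)).trans ?_
      rw [he]
      exact Category.comp_id _
    have : Mono (colim.map Ψ ≫ e X.obj) := mono_comp _ _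
    have htop : Subobject.mk (colim.map Ψ ≫ e X.obj) = ⊤ := by
      refine top_le_iff.1 (h.2 ?_)
      rintro _ ⟨p, rfl⟩
      obtain ⟨j, rfl⟩ : ∃ j, p = -j := ⟨-p, (neg_neg p).symm⟩
      exact Subobject.le_mk_of_comm (colimit.ι G j) (hm j)
    have := (Subobject.isIso_iff_mk_eq_top (colim.map Ψ ≫ e X.obj)).2 htop
    exact IsIso.of_isIso_comp_right _ (e X.obj)
  let fc : (Functor.const ℤ).obj T ⟶ (Functor.const ℤ).obj X.obj := (Functor.const ℤ).map f
  have sq := (IsPullback.of_hasPullback Ψ fc).map (colim : (ℤ ⥤ A) ⥤ A)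
  have : IsIso (colim.map (pullback.snd Ψ fc)) := sq.isIso_snd_of_isIso
  have : Epi U.arrow := by
    refine ⟨fun {W} g g' hg => ?_⟩
    rw [← cancel_epi (colim.map (pullback.snd Ψ fc) ≫ e T)]
    refine colimit.hom_ext fun j => ?_
    have hfac : U.Factors ((pullback.snd Ψ fc).app j) := by
      refine Subobject.factors_of_le _ (hU ⟨-j, rfl⟩) ?_
      rw [Subobject.factors_iff]
      have w := NatTrans.congr_app (pullback.condition (f := Ψ) (g := fc)) j
      exact ⟨(Subobject.isPullback f (X.F (-j))).lift ((pullback.fst Ψ fc).app j)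
        ((pullback.snd Ψ fc).app j) w, (Subobject.isPullback f (X.F (-j))).lift_snd _ _ w⟩
    have h1 (k : T ⟶ W) : colimit.ι (pullback Ψ fc) j ≫
        (colim.map (pullback.snd Ψ fc) ≫ e T) ≫ k = U.factorThru _ hfac ≫ U.arrow ≫ k := by
      have := congrArg (· ≫ k) (key (pullback.snd Ψ fc) j)
      simp only [Category.assoc] at this ⊢
      rw [this, Subobject.factorThru_arrow_assoc]
    exact (h1 g).trans ((congrArg _ hg).trans (h1 g').symm)
  have := isIso_of_mono_of_epi U.arrow
  exact (Subobject.eq_top_of_isIso_arrow U).ge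

end FilteredObject

end Filtered

section Main

variable (A : Type u) [Category.{v} A] [Abelian A] (κ : FiltrationType) (b : Boundedness)

/-- The filtered complexes whose filtrations satisfy the condition `κ` in each degree and which
satisfy the boundedness condition `b`. -/
def admissible : ObjectProperty (FilteredComplex A) :=
  fun K => (∀ n, κ.Holds (K.X n)) ∧ b.Holds K

/-- The category `C^b(FA)`. -/
abbrev CF := (admissible A κ b).FullSubcategory

/-- The class of `E_r`-quasi-isomorphisms in `C^b(FA)`. -/
def E (r : ℕ) : MorphismProperty (CF A κ b) :=
  (FilteredComplex.EQuasiIso A r).inverseImage (admissible A κ b).ι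

/-- The `r`-derived category `D_r^b(FA) = C^b(FA)[E_r⁻¹]`. -/
abbrev DF (r : ℕ) := (E A κ b r).Localization

/-- The décalage functor on `C^b(FA)`. -/
noncomputable def Dec : CF A κ b ⥤ CF A κ b :=
  (admissible A κ b).lift ((admissible A κ b).ι ⋙ FilteredComplex.decFunctor A)
    fun K => ⟨K.obj.dec_filtration κ K.property.1, K.obj.dec_bounded b K.property.2⟩

/-- The functor `D_{r+1}^b(FA) ⥤ D_r^b(FA)` induced by the décalage, that is, the unique functor
whose composition with the localization functor `C^b(FA) ⥤ D_{r+1}^b(FA)` is `Dec` followed by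
the localization functor `C^b(FA) ⥤ D_r^b(FA)`. It is defined as soon as `Dec` sends
`E_{r+1}`-quasi-isomorphisms to `E_r`-quasi-isomorphisms. -/
noncomputable def derivedDec (r : ℕ) (h : E A κ b (r + 1) ≤ (E A κ b r).inverseImage (Dec A κ b)) :
    DF A κ b (r + 1) ⥤ DF A κ b r :=
  Localization.Construction.lift (Dec A κ b ⋙ (E A κ b r).Q)
    fun _ _ f hf => (E A κ b r).Q_inverts _ (h f hf)

end Main

end FilteredDecalage

/-!
Let `S` be the functor which keeps the underlying complex and puts `(S F)^p K^n = F^{p-n} K^n`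
(`FilteredComplex.shift`). It preserves the conditions on filtrations and boundedness, and
`Dec (S K) = K` (`shiftDecIso`). Substituting in the definition of the spectral sequence gives
`Z_{s+1}^{p+n}(S K) = Z_s^p(K)`, hence `E_{r+1}(S K) = E_r(K)` up to reindexing; so `f` is an
`E_r`-quasi-isomorphism if and only if `S f` is an `E_{r+1}`-quasi-isomorphism
(`eQuasiIso_shift_iff`).

In the other order, the filtration of `S (Dec K)` is `Z_1^p K^n ⊆ F^p K^n`, so that the identity
of the underlying complex is a natural morphism `S (Dec K) ⟶ K`. It is an
`E_{r+1}`-quasi-isomorphism for all `r ≥ 0` (`eQuasiIso_counitApp`). Indeed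
`Z_s^p(S (Dec K)) = Z_{max(s,1)}^p(K)`, so that `E_r(S (Dec K)) = E_r(K)` when `r ≥ 2`. When
`r = 1` both pages are quotients of `Z_1^p K^n`, by `Z_1^{p+1} K^n + d(Z_1^p K^{n-1})` and by
`F^{p+1} K^n + d(F^p K^{n-1})` respectively, and a diagram chase shows that the projection is a
quasi-isomorphism.

By naturality and the two-out-of-three property, `Dec f` is an `E_r`-quasi-isomorphism if and only
if `f` is an `E_{r+1}`-quasi-isomorphism (`eQuasiIso_dec_iff`). Therefore `Dec` and `S` both
descend to the localizations, where they are quasi-inverse to each other. No convergence of the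
spectral sequences is involved.

Diagram chases use generalized elements: a morphism `x : T ⟶ X` is an element of `X`, it lies in a
subobject `G` of `X` when `G.Factors x`, and existence statements hold after composition with an
epimorphism `T' ⟶ T`.
-/

namespace FilteredDecalage

/-! ### Generalized elements of subobjects and subquotients -/

section Elements

variable {A : Type u} [Category.{v} A] [Abelian A]

theorem factors_preimage_iff {X Y T : A} (f : X ⟶ Y) (G : Subobject Y) (x : T ⟶ X) :
    (preimage f G).Factors x ↔ G.Factors (x ≫ f) := by
  constructor
  · intro h
    rw [Subobject.factors_iff]
    refine ⟨(preimage f G).factorThru x h ≫ Subobject.pullbackπ f G, ?_⟩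
    change ((preimage f G).factorThru x h ≫ Subobject.pullbackπ f G) ≫ G.arrow = _
    rw [Category.assoc, (Subobject.isPullback f G).w, Subobject.factorThru_arrow_assoc]
  · intro h
    rw [Subobject.factors_iff]
    exact ⟨(Subobject.isPullback f G).lift (G.factorThru _ h) x (by simp),
      (Subobject.isPullback f G).lift_snd _ _ _⟩

theorem factors_inf_iff {X T : A} (G H : Subobject X) (x : T ⟶ X) :
    (G ⊓ H).Factors x ↔ G.Factors x ∧ H.Factors x :=
  Subobject.inf_factors x

/-- A generalized element of `f(G)` comes, after passing to an epimorphism onto its source, from a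
generalized element of `G`. -/
theorem factors_directImage {X Y T : A} (f : X ⟶ Y) (G : Subobject X) (y : T ⟶ Y)
    (hy : (directImage f G).Factors y) :
    ∃ (T' : A) (π : T' ⟶ T) (_ : Epi π) (x : T' ⟶ X), G.Factors x ∧ π ≫ y = x ≫ f := by
  obtain ⟨T', π, hπ, x, hx⟩ := surjective_up_to_refinements_of_epi
    (factorThruImageSubobject (G.arrow ≫ f)) ((directImage f G).factorThru y hy)
  refine ⟨T', π, hπ, x ≫ G.arrow, Subobject.factors_comp_arrow x, ?_⟩
  have := congrArg (· ≫ (directImage f G).arrow) hx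
  simpa using this

/-- A generalized element of `G ⊔ H` is, after passing to an epimorphism onto its source, a sum of
generalized elements of `G` and `H`. -/
theorem factors_sup {X T : A} (G H : Subobject X) (y : T ⟶ X) (hy : (G ⊔ H).Factors y) :
    ∃ (T' : A) (π : T' ⟶ T) (_ : Epi π) (a b : T' ⟶ X),
      G.Factors a ∧ H.Factors b ∧ π ≫ y = a + b := by
  have hle : G ⊔ H ≤ imageSubobject (biprod.desc G.arrow H.arrow) := by
    refine sup_le ?_ ?_
    · refine Subobject.le_of_comm (biprod.inl ≫ factorThruImageSubobject _) (by simp)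
    · refine Subobject.le_of_comm (biprod.inr ≫ factorThruImageSubobject _) (by simp)
  -- By `hle`, `y` lifts to the image of `G ⊞ H ⟶ X`, onto which `G ⊞ H` maps epimorphically.
  obtain ⟨T', π, hπ, x, hx⟩ := surjective_up_to_refinements_of_epi
    (factorThruImageSubobject (biprod.desc G.arrow H.arrow))
    (Subobject.factorThru _ y (Subobject.factors_of_le y hle hy))
  refine ⟨T', π, hπ, (x ≫ biprod.fst) ≫ G.arrow, (x ≫ biprod.snd) ≫ H.arrow,
    Subobject.factors_comp_arrow _, Subobject.factors_comp_arrow _, ?_⟩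
  have := congrArg (· ≫ (imageSubobject (biprod.desc G.arrow H.arrow)).arrow) hx
  simpa [biprod.desc_eq] using this

theorem factors_add {X T : A} (G : Subobject X) {x y : T ⟶ X} (hx : G.Factors x)
    (hy : G.Factors y) : G.Factors (x + y) := by
  rw [Subobject.factors_iff]
  refine ⟨G.factorThru x hx + G.factorThru y hy, ?_⟩
  change _ ≫ G.arrow = _
  rw [Preadditive.add_comp, Subobject.factorThru_arrow, Subobject.factorThru_arrow]

theorem factors_sub {X T : A} (G : Subobject X) {x y : T ⟶ X} (hx : G.Factors x)
    (hy : G.Factors y) : G.Factors (x - y) := by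
  rw [Subobject.factors_iff]
  refine ⟨G.factorThru x hx - G.factorThru y hy, ?_⟩
  change _ ≫ G.arrow = _
  rw [Preadditive.sub_comp, Subobject.factorThru_arrow, Subobject.factorThru_arrow]

/-- The generalized element of `Z / B` represented by a generalized element `x` of `X` lying
in `Z`. -/
noncomputable def subquotientMk {X T : A} {B Z : Subobject X} (h : B ≤ Z) (x : T ⟶ X)
    (hx : Z.Factors x) : T ⟶ subquotient h :=
  Z.factorThru x hx ≫ subquotientπ h

theorem exists_subquotientMk {X T : A} {B Z : Subobject X} (h : B ≤ Z) (y : T ⟶ subquotient h) :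
    ∃ (T' : A) (π : T' ⟶ T) (_ : Epi π) (x : T' ⟶ X) (hx : Z.Factors x),
      π ≫ y = subquotientMk h x hx := by
  have : Epi (subquotientπ h) := inferInstanceAs (Epi (cokernel.π _))
  obtain ⟨T', π, hπ, x, hx⟩ := surjective_up_to_refinements_of_epi (subquotientπ h) y
  refine ⟨T', π, hπ, x ≫ Z.arrow, Subobject.factors_comp_arrow x, ?_⟩
  have e : Z.factorThru (x ≫ Z.arrow) (Subobject.factors_comp_arrow x) = x := by
    rw [← cancel_mono Z.arrow, Subobject.factorThru_arrow]
  rw [hx, subquotientMk, e]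

theorem comp_subquotientMk {X T T' : A} {B Z : Subobject X} (h : B ≤ Z) (π : T' ⟶ T)
    (x : T ⟶ X) (hx : Z.Factors x) :
    π ≫ subquotientMk h x hx =
      subquotientMk h (π ≫ x) (Subobject.factors_of_factors_right π hx) := by
  have e : π ≫ Z.factorThru x hx =
      Z.factorThru (π ≫ x) (Subobject.factors_of_factors_right π hx) := by
    rw [← cancel_mono Z.arrow]
    simp
  rw [subquotientMk, subquotientMk, ← Category.assoc, e]

theorem subquotientMk_map {X Y T : A} {B Z : Subobject X} {B' Z' : Subobject Y}
    (h : B ≤ Z) (h' : B' ≤ Z') (f : X ⟶ Y) (hZ : Z ≤ preimage f Z') (hB : B ≤ preimage f B')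
    (x : T ⟶ X) (hx : Z.Factors x) :
    subquotientMk h x hx ≫ subquotientMap h h' f hZ hB =
      subquotientMk h' (x ≫ f)
        ((factors_preimage_iff f Z' x).1 (Subobject.factors_of_le x hZ hx)) := by
  have e : Z.factorThru x hx ≫ restrict f hZ = Z'.factorThru (x ≫ f)
      ((factors_preimage_iff f Z' x).1 (Subobject.factors_of_le x hZ hx)) := by
    rw [← cancel_mono Z'.arrow]
    simp
  rw [subquotientMk, subquotientMk, Category.assoc, subquotientπ_map, ← Category.assoc, e]

theorem subquotientMk_eq_zero_iff {X T : A} {B Z : Subobject X} (h : B ≤ Z) (x : T ⟶ X)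
    (hx : Z.Factors x) : subquotientMk h x hx = 0 ↔ B.Factors x := by
  constructor
  · intro hzero
    have hex := ShortComplex.exact_cokernel (Subobject.ofLE B Z h)
    have : Mono (ShortComplex.mk _ _ (cokernel.condition (Subobject.ofLE B Z h))).f :=
      inferInstanceAs (Mono (Subobject.ofLE B Z h))
    have e := hex.lift_f (Z.factorThru x hx) hzero
    rw [Subobject.factors_iff]
    refine ⟨hex.lift (Z.factorThru x hx) hzero, ?_⟩
    have e' := congrArg (· ≫ Z.arrow) e
    simpa using e'
  · intro hB
    have e : Z.factorThru x hx = B.factorThru x hB ≫ Subobject.ofLE B Z h := by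
      rw [← cancel_mono Z.arrow]
      simp
    have e' : Subobject.ofLE B Z h ≫ subquotientπ h = 0 := cokernel.condition _
    rw [subquotientMk, e, Category.assoc, e', comp_zero]

theorem subquotientMk_eq_iff {X T : A} {B Z : Subobject X} (h : B ≤ Z) (x y : T ⟶ X)
    (hx : Z.Factors x) (hy : Z.Factors y) :
    subquotientMk h x hx = subquotientMk h y hy ↔ B.Factors (x - y) := by
  have hxy : Z.Factors (x - y) := factors_sub Z hx hy
  have e : subquotientMk h x hx - subquotientMk h y hy = subquotientMk h (x - y) hxy := by
    rw [subquotientMk, subquotientMk, subquotientMk, ← Preadditive.sub_comp]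
    congr 1
    rw [← cancel_mono Z.arrow]
    simp
  rw [← sub_eq_zero, e, subquotientMk_eq_zero_iff]

/-- Equal pairs `B ≤ Z` of subobjects of `X` have isomorphic subquotients. -/
noncomputable def subquotientCongr {X : A} {B Z B' Z' : Subobject X} (h : B ≤ Z) (h' : B' ≤ Z')
    (hZ : Z = Z') (hB : B = B') : subquotient h ≅ subquotient h' where
  hom := subquotientMap h h' (𝟙 X) (by rw [preimage, Subobject.pullback_id, hZ])
    (by rw [preimage, Subobject.pullback_id, hB])
  inv := subquotientMap h' h (𝟙 X) (by rw [preimage, Subobject.pullback_id, hZ])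
    (by rw [preimage, Subobject.pullback_id, hB])
  hom_inv_id := by
    subst hZ hB
    rw [subquotientMap_id, Category.id_comp]
  inv_hom_id := by
    subst hZ hB
    rw [subquotientMap_id, Category.id_comp]

theorem subquotientCongr_hom_naturality {X Y : A} {B₁ Z₁ B₁' Z₁' : Subobject X}
    {B₂ Z₂ B₂' Z₂' : Subobject Y} (h₁ : B₁ ≤ Z₁) (h₁' : B₁' ≤ Z₁') (h₂ : B₂ ≤ Z₂)
    (h₂' : B₂' ≤ Z₂') (hZ₁ : Z₁ = Z₁') (hB₁ : B₁ = B₁') (hZ₂ : Z₂ = Z₂') (hB₂ : B₂ = B₂')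
    (f : X ⟶ Y) (hZ : Z₁ ≤ preimage f Z₂) (hB : B₁ ≤ preimage f B₂)
    (hZ' : Z₁' ≤ preimage f Z₂') (hB' : B₁' ≤ preimage f B₂') :
    (subquotientCongr h₁ h₁' hZ₁ hB₁).hom ≫ subquotientMap h₁' h₂' f hZ' hB' =
      subquotientMap h₁ h₂ f hZ hB ≫ (subquotientCongr h₂ h₂' hZ₂ hB₂).hom := by
  subst hZ₁ hB₁ hZ₂ hB₂
  simp only [subquotientCongr, subquotientMap_id, Category.id_comp, Category.comp_id]

end Elements

/-! ### The functor `S` and its effect on the spectral sequence -/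

section Shift

variable {A : Type u} [Category.{v} A] [Abelian A]

namespace FilteredComplex

theorem factors_F_of_le (K : FilteredComplex A) {n p q : ℤ} {T : A} {x : T ⟶ (K.X n).obj}
    (hx : ((K.X n).F p).Factors x) (h : q ≤ p) : ((K.X n).F q).Factors x :=
  Subobject.factors_of_le x ((K.X n).anti h) hx

theorem factors_Z_iff (K : FilteredComplex A) {s p n n' t : ℤ} (hn : n + 1 = n') (ht : p + s = t)
    {T : A} (x : T ⟶ (K.X n).obj) :
    (K.Z s p n).Factors x ↔
      ((K.X n).F p).Factors x ∧ ((K.X n').F t).Factors (x ≫ K.diff n n') := by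
  subst hn ht
  rw [Z, factors_inf_iff, factors_preimage_iff]

theorem factors_B (K : FilteredComplex A) {s p m n : ℤ} (hm : m + 1 = n)
    {T : A} (y : T ⟶ (K.X n).obj) (hy : (K.B s p n).Factors y) :
    ∃ (T' : A) (π : T' ⟶ T) (_ : Epi π) (a : T' ⟶ (K.X n).obj) (c : T' ⟶ (K.X m).obj),
      (K.Z (s - 1) (p + 1) n).Factors a ∧ (K.Z (s - 1) (p - s + 1) m).Factors c ∧
        π ≫ y = a + c ≫ K.diff m n := by
  obtain rfl : m = n - 1 := by lia
  obtain ⟨T₁, π₁, _, a, b, ha, hb, h₁⟩ := factors_sup _ _ y hy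
  obtain ⟨T₂, π₂, _, c, hc, h₂⟩ := factors_directImage _ _ b hb
  exact ⟨T₂, π₂ ≫ π₁, inferInstance, π₂ ≫ a, c, Subobject.factors_of_factors_right _ ha, hc, by
    rw [Category.assoc, h₁, Preadditive.comp_add, h₂]⟩

/-- A version of `page_d` for indices that are only propositionally equal to `p + r` and `n + 1`. -/
theorem page_d_eq (K : FilteredComplex A) (r : ℕ) {p n p' n' : ℤ} (hp : p + r = p')
    (hn : n + 1 = n') :
    (K.page r).d (p, n) (p', n') =
      subquotientMap (K.B_le_Z r p n) (K.B_le_Z r p' n') (K.diff n n')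
        (hp ▸ K.Z_le_preimage_diff r p n n' hn r) (hp ▸ K.B_le_preimage_diff r p n n' hn) := by
  subst hp hn
  exact K.page_d r p n

/-- The filtered complex `S K` with the underlying complex of `K` and the filtration
`(S F)^p K^n = F^{p-n} K^n`. -/
def shift (K : FilteredComplex A) : FilteredComplex A where
  X n := ⟨(K.X n).obj, fun p => (K.X n).F (p - n), fun _ _ h => (K.X n).anti (by lia)⟩
  d m n := ⟨K.diff m n, fun p => by
    by_cases h : m + 1 = n
    · exact ((K.d m n).map_le _).trans (preimage_mono _ ((K.X n).anti (by lia)))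
    · rw [K.diff_shape m n h, preimage_zero]
      exact le_top⟩
  shape m n h := FilteredObject.hom_ext (K.diff_shape m n h)
  d_comp_d' l m n _ _ := FilteredObject.hom_ext (K.diff_comp l m n)

/-- The functor `S`, the identity on underlying morphisms. -/
def shiftFunctor (A : Type u) [Category.{v} A] [Abelian A] :
    FilteredComplex A ⥤ FilteredComplex A where
  obj K := K.shift
  map f :=
    { f n := ⟨(f.f n).hom, fun _ => (f.f n).map_le _⟩
      comm' m n _ := FilteredObject.hom_ext (comm f m n) }
  map_id _ := rfl
  map_comp _ _ := rfl

theorem shift_Z (K : FilteredComplex A) {s p n s' p' : ℤ} (hs : s' = s + 1) (hp : p' = p + n) :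
    K.shift.Z s' p' n = K.Z s p n := by
  have h₁ : p' - n = p := by lia
  have h₂ : p' + s' - (n + 1) = p + s := by lia
  change (K.X n).F (p' - n) ⊓ preimage (K.diff n (n + 1)) ((K.X (n + 1)).F (p' + s' - (n + 1))) = _
  rw [h₁, h₂, Z]

theorem shift_B (K : FilteredComplex A) {s p n s' p' : ℤ} (hs : s' = s + 1) (hp : p' = p + n) :
    K.shift.B s' p' n = K.B s p n := by
  rw [B, B, K.shift_Z (s := s - 1) (p := p + 1) (by lia) (by lia),
    K.shift_Z (s := s - 1) (p := p - s + 1) (n := n - 1) (by lia) (by lia)]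
  rfl

/-- The isomorphism `E_{r+1}(S K) ≅ E_r(K)` in bidegree `(p, n)`. -/
noncomputable def shiftPageXIso (K : FilteredComplex A) (r : ℕ) {p n p' : ℤ} (hp : p' = p + n) :
    (K.shift.page (r + 1)).X (p', n) ≅ (K.page r).X (p, n) :=
  subquotientCongr (K.shift.B_le_Z (r + 1) p' n) (K.B_le_Z r p n)
    (K.shift_Z (by push_cast; rfl) hp) (K.shift_B (by push_cast; rfl) hp)

theorem shiftPageXIso_hom_d (K : FilteredComplex A) (r : ℕ) {p n p' q m q' : ℤ} (hp : p' = p + n)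
    (hq : q' = q + m) (h : p + r = q) (hn : n + 1 = m) :
    (K.shiftPageXIso r hp).hom ≫ (K.page r).d (p, n) (q, m) =
      (K.shift.page (r + 1)).d (p', n) (q', m) ≫ (K.shiftPageXIso r hq).hom := by
  rw [K.page_d_eq r h hn, K.shift.page_d_eq (r + 1) (by push_cast; lia) hn]
  exact subquotientCongr_hom_naturality _ _ _ _ _ _ _ _ _ _ _ _ _

theorem shiftPageXIso_hom_naturality {K L : FilteredComplex A} (f : K ⟶ L) (r : ℕ) {p n p' : ℤ}
    (hp : p' = p + n) :
    (K.shiftPageXIso r hp).hom ≫ (pageMap f r).f (p, n) =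
      (pageMap ((shiftFunctor A).map f) (r + 1)).f (p', n) ≫ (L.shiftPageXIso r hp).hom :=
  subquotientCongr_hom_naturality _ _ _ _ _ _ _ _ _
    (Z_le_preimage ((shiftFunctor A).map f) _ _ _) (B_le_preimage ((shiftFunctor A).map f) _ _ _)
    (Z_le_preimage f _ _ _) (B_le_preimage f _ _ _)

/-- The isomorphism between the parts of `E_{r+1}(S K)` and `E_r(K)` which compute the homology in
bidegrees `(p + n, n)` and `(p, n)`: the degrees `(r + 1, 1)` and `(r, 1)` of the two differentials
match under the reindexing `(p, n) ↦ (p + n, n)`. -/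
noncomputable def shiftPageScIso (K : FilteredComplex A) (r : ℕ) (p n : ℤ) :
    (K.shift.page (r + 1)).sc' (p + n - (r + 1), n - 1) (p + n, n) (p + n + (r + 1), n + 1) ≅
      (K.page r).sc' (p - r, n - 1) (p, n) (p + r, n + 1) :=
  ShortComplex.isoMk (K.shiftPageXIso r (by lia)) (K.shiftPageXIso r rfl)
    (K.shiftPageXIso r (by lia))
    (K.shiftPageXIso_hom_d r (by lia) rfl (by lia) (by lia))
    (K.shiftPageXIso_hom_d r rfl (by lia) rfl rfl)

theorem page_prev (r : ℕ) {p n p' n' : ℤ} (hp : p' + r = p) (hn : n' + 1 = n) :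
    (ComplexShape.up' ((r, 1) : ℤ × ℤ)).prev (p, n) = (p', n') :=
  ComplexShape.prev_eq' _ (Prod.ext hp hn)

theorem page_next (r : ℕ) {p n p' n' : ℤ} (hp : p + r = p') (hn : n + 1 = n') :
    (ComplexShape.up' ((r, 1) : ℤ × ℤ)).next (p, n) = (p', n') :=
  ComplexShape.next_eq' _ (Prod.ext hp hn)

theorem quasiIsoAt_pageMap_shift_iff {K L : FilteredComplex A} (f : K ⟶ L) (r : ℕ) (p n : ℤ) :
    QuasiIsoAt (pageMap ((shiftFunctor A).map f) (r + 1)) (p + n, n) ↔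
      QuasiIsoAt (pageMap f r) (p, n) := by
  rw [quasiIsoAt_iff' _ (p + n - (r + 1), n - 1) (p + n, n) (p + n + (r + 1), n + 1)
      (page_prev _ (by push_cast; lia) (by lia)) (page_next _ (by push_cast; lia) rfl),
    quasiIsoAt_iff' _ (p - r, n - 1) (p, n) (p + r, n + 1)
      (page_prev _ (by lia) (by lia)) (page_next _ rfl rfl)]
  refine ShortComplex.quasiIso_iff_of_arrow_mk_iso _ _
    (Arrow.isoMk (K.shiftPageScIso r p n) (L.shiftPageScIso r p n) ?_)
  ext
  · exact shiftPageXIso_hom_naturality f r (by lia)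
  · exact shiftPageXIso_hom_naturality f r rfl
  · exact shiftPageXIso_hom_naturality f r (by lia)

theorem eQuasiIso_shift_iff {K L : FilteredComplex A} (f : K ⟶ L) (r : ℕ) :
    EQuasiIso A (r + 1) ((shiftFunctor A).map f) ↔ EQuasiIso A r f := by
  constructor
  · intro h
    refine ⟨fun ⟨p, n⟩ => (quasiIsoAt_pageMap_shift_iff f r p n).1 (h.quasiIsoAt _)⟩
  · intro h
    refine ⟨fun ⟨p, n⟩ => ?_⟩
    obtain ⟨q, rfl⟩ : ∃ q, p = q + n := ⟨p - n, by lia⟩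
    exact (quasiIsoAt_pageMap_shift_iff f r q n).2 (h.quasiIsoAt _)

end FilteredComplex

end Shift

/-! ### The morphism `S (Dec K) ⟶ K` -/

section Counit

variable {A : Type u} [Category.{v} A] [Abelian A]

namespace FilteredComplex

theorem shift_dec_F_le (K : FilteredComplex A) (n p : ℤ) :
    (K.dec.shift.X n).F p ≤ (K.X n).F p :=
  inf_le_left.trans ((K.X n).anti (by lia))

/-- The morphism `S (Dec K) ⟶ K` given by the identity of the underlying complex. -/
noncomputable def counitApp (K : FilteredComplex A) : K.dec.shift ⟶ K where
  f n := ⟨𝟙 (K.X n).obj, fun p => (K.shift_dec_F_le n p).trans (Subobject.pullback_id _).ge⟩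
  comm' m n _ := FilteredObject.hom_ext
    ((Category.id_comp _).trans (Category.comp_id (K.diff m n)).symm)

/-- The natural transformation `S ∘ Dec ⟶ 𝟭` with components `counitApp`. -/
noncomputable def counit (A : Type u) [Category.{v} A] [Abelian A] :
    decFunctor A ⋙ shiftFunctor A ⟶ 𝟭 (FilteredComplex A) where
  app := counitApp
  naturality K L f := by
    ext n
    exact (Category.comp_id (f.f n).hom).trans (Category.id_comp _).symm

/-- As `d ∘ d = 0`, the cycles `Z_s^p` of `S (Dec K)` consist of the `x ∈ F^p` such that
`d x ∈ F^{p+1} ∩ F^{p+s}`. -/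
theorem shift_dec_Z (K : FilteredComplex A) (s p n : ℤ) :
    K.dec.shift.Z s p n = K.Z (max s 1) p n := by
  change (K.X n).F (p - n + n) ⊓
      preimage (K.diff n (n + 1)) ((K.X (n + 1)).F (p - n + n + 1)) ⊓
    preimage (K.diff n (n + 1)) ((K.X (n + 1)).F (p + s - (n + 1) + (n + 1)) ⊓
      preimage (K.diff (n + 1) (n + 1 + 1))
        ((K.X (n + 1 + 1)).F (p + s - (n + 1) + (n + 1) + 1))) = _
  rw [preimage_inf, ← preimage_comp, diff_comp, preimage_zero, inf_top_eq, inf_assoc,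
    ← preimage_inf, sub_add_cancel, sub_add_cancel, Z]
  congr 2
  rcases le_total s 1 with h | h
  · rw [max_eq_right h, inf_eq_left]
    exact (K.X (n + 1)).anti (by lia)
  · rw [max_eq_left h, inf_eq_right]
    exact (K.X (n + 1)).anti (by lia)

theorem shift_dec_B (K : FilteredComplex A) {s : ℤ} (hs : 2 ≤ s) (p n : ℤ) :
    K.dec.shift.B s p n = K.B s p n := by
  rw [B, B, shift_dec_Z, shift_dec_Z, max_eq_left (by lia)]
  rfl

/-- For `r ≥ 2` only the `Z_s` with `s ≥ 1` occur in `E_r`, and these are the same for `S (Dec K)`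
and `K`: the two pages coincide. -/
theorem eQuasiIso_counitApp_of_two_le (K : FilteredComplex A) (r : ℕ) (hr : 2 ≤ r) :
    EQuasiIso A r K.counitApp := by
  have hZ (p n : ℤ) : K.dec.shift.Z r p n = K.Z r p n := by
    rw [shift_dec_Z, max_eq_left (by lia)]
  have (i : ℤ × ℤ) : IsIso ((pageMap K.counitApp r).f i) :=
    (subquotientCongr (K.dec.shift.B_le_Z r i.1 i.2) (K.B_le_Z r i.1 i.2)
      (hZ _ _) (K.shift_dec_B (by lia) _ _)).isIso_hom
  have : IsIso (pageMap K.counitApp r) := HomologicalComplex.Hom.isIso_of_components _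
  exact inferInstanceAs (QuasiIso (pageMap K.counitApp r))

/-- The generalized element of `E_r^{p,n-p}(K)` represented by a generalized element of
`Z_r^p K^n`. -/
noncomputable def pageMk (K : FilteredComplex A) (r : ℕ) {p n : ℤ} {T : A}
    (x : T ⟶ (K.X n).obj) (hx : (K.Z r p n).Factors x) : T ⟶ (K.page r).X (p, n) :=
  subquotientMk (K.B_le_Z r p n) x hx

theorem exists_pageMk (K : FilteredComplex A) (r : ℕ) {p n : ℤ} {T : A}
    (y : T ⟶ (K.page r).X (p, n)) :
    ∃ (T' : A) (π : T' ⟶ T) (_ : Epi π) (x : T' ⟶ (K.X n).obj) (hx : (K.Z r p n).Factors x),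
      π ≫ y = K.pageMk r x hx :=
  exists_subquotientMk _ y

theorem comp_pageMk (K : FilteredComplex A) (r : ℕ) {p n : ℤ} {T T' : A} (π : T' ⟶ T)
    (x : T ⟶ (K.X n).obj) (hx : (K.Z r p n).Factors x) :
    π ≫ K.pageMk r x hx = K.pageMk r (π ≫ x) (Subobject.factors_of_factors_right π hx) :=
  comp_subquotientMk _ π x hx

theorem factors_Z_diff (K : FilteredComplex A) {s p n p' n' : ℤ} (t : ℤ) (hp : p + s = p')
    (hn : n + 1 = n') {T : A} {x : T ⟶ (K.X n).obj} (hx : (K.Z s p n).Factors x) :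
    (K.Z t p' n').Factors (x ≫ K.diff n n') := by
  subst hp
  exact (factors_preimage_iff _ _ _).1
    (Subobject.factors_of_le x (K.Z_le_preimage_diff s p n n' hn t) hx)

theorem pageMk_d (K : FilteredComplex A) (r : ℕ) {p n p' n' : ℤ} (hp : p + r = p')
    (hn : n + 1 = n') {T : A} (x : T ⟶ (K.X n).obj) (hx : (K.Z r p n).Factors x) :
    K.pageMk r x hx ≫ (K.page r).d (p, n) (p', n') =
      K.pageMk r (x ≫ K.diff n n') (K.factors_Z_diff r hp hn hx) :=
  (congrArg (K.pageMk r x hx ≫ ·) (K.page_d_eq r hp hn)).trans (subquotientMk_map _ _ _ _ _ x hx)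

theorem pageMk_eq_zero_iff (K : FilteredComplex A) (r : ℕ) {p n : ℤ} {T : A}
    (x : T ⟶ (K.X n).obj) (hx : (K.Z r p n).Factors x) :
    K.pageMk r x hx = 0 ↔ (K.B r p n).Factors x :=
  subquotientMk_eq_zero_iff _ x hx

theorem pageMk_eq_iff (K : FilteredComplex A) (r : ℕ) {p n : ℤ} {T : A}
    (x y : T ⟶ (K.X n).obj) (hx : (K.Z r p n).Factors x) (hy : (K.Z r p n).Factors y) :
    K.pageMk r x hx = K.pageMk r y hy ↔ (K.B r p n).Factors (x - y) :=
  subquotientMk_eq_iff _ x y hx hy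

theorem factors_F_diff (K : FilteredComplex A) {m n p q : ℤ} (h : q ≤ p) {T : A}
    {x : T ⟶ (K.X m).obj} (hx : ((K.X m).F p).Factors x) :
    ((K.X n).F q).Factors (x ≫ K.diff m n) :=
  K.factors_F_of_le ((factors_preimage_iff _ _ _).1
    (Subobject.factors_of_le x ((K.d m n).map_le p) hx)) h

/-- Elements of `F^{p+1} K^n` vanish in `E_1^{p,n-p}(K)`. -/
theorem factors_B_one_of_F (K : FilteredComplex A) {p n : ℤ} {T : A} {x : T ⟶ (K.X n).obj}
    (hx : ((K.X n).F (p + 1)).Factors x) : (K.B (1 : ℕ) p n).Factors x :=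
  Subobject.factors_of_le x le_sup_left
    ((K.factors_Z_iff rfl rfl x).2 ⟨hx, K.factors_F_diff (by lia) hx⟩)

theorem shift_dec_Z_one (K : FilteredComplex A) (p n : ℤ) :
    K.dec.shift.Z (1 : ℕ) p n = K.Z (1 : ℕ) p n := by
  rw [shift_dec_Z]
  rfl

/-- The generalized element of `E_1^{p,n-p}(S (Dec K))` represented by a generalized element of
`Z_1^p K^n`: this is `pageMk` for the complex `S (Dec K)`, its objects being identified with those
of `K` and its `Z_1^p` with that of `K`. -/
noncomputable def shiftDecPageMk (K : FilteredComplex A) {p n : ℤ} {T : A}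
    (x : T ⟶ (K.X n).obj) (hx : (K.Z (1 : ℕ) p n).Factors x) :
    T ⟶ (K.dec.shift.page 1).X (p, n) :=
  K.dec.shift.pageMk 1 (p := p) (n := n) x
    (Subobject.factors_of_le x (K.shift_dec_Z_one p n).ge hx)

theorem exists_shiftDecPageMk (K : FilteredComplex A) {p n : ℤ} {T : A}
    (y : T ⟶ (K.dec.shift.page 1).X (p, n)) :
    ∃ (T' : A) (π : T' ⟶ T) (_ : Epi π) (x : T' ⟶ (K.X n).obj)
      (hx : (K.Z (1 : ℕ) p n).Factors x), π ≫ y = K.shiftDecPageMk x hx := by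
  obtain ⟨T', π, hπ, x, hx, h⟩ := K.dec.shift.exists_pageMk 1 y
  exact ⟨T', π, hπ, x, Subobject.factors_of_le x (K.shift_dec_Z_one p n).le hx, h⟩

theorem comp_shiftDecPageMk (K : FilteredComplex A) {p n : ℤ} {T T' : A} (π : T' ⟶ T)
    (x : T ⟶ (K.X n).obj) (hx : (K.Z (1 : ℕ) p n).Factors x) :
    π ≫ K.shiftDecPageMk x hx =
      K.shiftDecPageMk (π ≫ x) (Subobject.factors_of_factors_right π hx) :=
  K.dec.shift.comp_pageMk 1 π x _

theorem shiftDecPageMk_d (K : FilteredComplex A) {p n p' n' : ℤ} (hp : p + (1 : ℕ) = p')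
    (hn : n + 1 = n') {T : A} (x : T ⟶ (K.X n).obj) (hx : (K.Z (1 : ℕ) p n).Factors x) :
    K.shiftDecPageMk x hx ≫ (K.dec.shift.page 1).d (p, n) (p', n') =
      K.shiftDecPageMk (x ≫ K.diff n n') (K.factors_Z_diff _ hp hn hx) :=
  K.dec.shift.pageMk_d 1 hp hn x _

theorem shiftDecPageMk_eq (K : FilteredComplex A) {p n : ℤ} {T : A} (x y : T ⟶ (K.X n).obj)
    (hx : (K.Z (1 : ℕ) p n).Factors x) (hy : (K.Z (1 : ℕ) p n).Factors y)
    (h : (K.Z 1 (p + 1) n).Factors (x - y)) : K.shiftDecPageMk x hx = K.shiftDecPageMk y hy := by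
  refine (K.dec.shift.pageMk_eq_iff 1 x y _ _).2 ?_
  have hle : K.Z 1 (p + 1) n ≤ K.dec.shift.B (1 : ℕ) p n := by
    refine le_trans ?_ le_sup_left
    rw [shift_dec_Z]
    rfl
  exact Subobject.factors_of_le _ hle h

/-- The kernel of `Z_1^p K^n ⟶ E_1^{p,n-p}(S (Dec K))` is `Z_1^{p+1} K^n + d(Z_1^p K^{n-1})`, since
`Z_0` of `S (Dec K)` is `Z_1` of `K`. -/
theorem exists_of_shiftDecPageMk_eq_zero (K : FilteredComplex A) {p m n : ℤ} (hm : m + 1 = n)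
    {T : A} (x : T ⟶ (K.X n).obj) (hx : (K.Z (1 : ℕ) p n).Factors x)
    (h : K.shiftDecPageMk x hx = 0) :
    ∃ (T' : A) (π : T' ⟶ T) (_ : Epi π) (a : T' ⟶ (K.X n).obj) (c : T' ⟶ (K.X m).obj),
      (K.Z 1 (p + 1) n).Factors a ∧ (K.Z 1 p m).Factors c ∧ π ≫ x = a + c ≫ K.diff m n := by
  obtain ⟨T', π, hπ, a, c, ha, hc, e⟩ :=
    K.dec.shift.factors_B hm x ((K.dec.shift.pageMk_eq_zero_iff 1 x _).1 h)
  rw [shift_dec_Z] at ha hc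
  have hp : p - (1 : ℕ) + 1 = p := by simp
  rw [hp] at hc
  exact ⟨T', π, hπ, a, c, ha, hc, e⟩

theorem shiftDecPageMk_counitApp (K : FilteredComplex A) {p n : ℤ} {T : A}
    (x : T ⟶ (K.X n).obj) (hx : (K.Z (1 : ℕ) p n).Factors x) :
    K.shiftDecPageMk x hx ≫ (pageMap K.counitApp 1).f (p, n) = K.pageMk 1 x hx := by
  refine (subquotientMk_map _ _ _ (Z_le_preimage K.counitApp _ _ _)
    (B_le_preimage K.counitApp _ _ _) x _).trans ?_
  have e : x ≫ (K.counitApp.f n).hom = x := Category.comp_id x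
  unfold pageMk
  congr 1

/-- Suppose that `x ∈ Z_1^p` represents a cycle of `E_1(S (Dec K))` and a boundary of `E_1(K)`:
`d x = z + d w` with `z ∈ Z_1^{p+2}`, `w ∈ Z_1^{p+1}`, and `x = d y + a + d c` with
`y ∈ Z_1^{p-1}`, `a ∈ F^{p+1}`, `c ∈ F^p`. Then `d a = d x` lies in `F^{p+2}`, hence
`a ∈ Z_1^{p+1}` vanishes in `E_1(S (Dec K))`, and `x` represents the
differential of the class of `y + c ∈ Z_1^{p-1}`. -/
theorem mono_homologyMap_counitApp (K : FilteredComplex A) (p n : ℤ) :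
    Mono (HomologicalComplex.homologyMap (pageMap K.counitApp 1) (p, n)) := by
  rw [HomologicalComplex.mono_homologyMap_iff_up_to_refinements _ (p - 1, n - 1) (p, n)
    (p + 1, n + 1) (page_prev 1 (by simp) (by simp)) (page_next 1 (by simp) rfl)]
  intro T x₂ hx₂ y₁ hy
  obtain ⟨T₁, π₁, _, x, hx, ex⟩ := K.exists_shiftDecPageMk x₂
  obtain ⟨T₂, π₂, _, y, hyZ, ey⟩ := K.exists_pageMk 1 (π₁ ≫ y₁)
  have hxy : (K.B (1 : ℕ) p n).Factors (π₂ ≫ x - y ≫ K.diff (n - 1) n) := by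
    rw [← K.pageMk_eq_iff 1 (π₂ ≫ x) (y ≫ K.diff (n - 1) n)
        (Subobject.factors_of_factors_right _ hx) (K.factors_Z_diff _ (by simp) (by simp) hyZ),
      ← K.comp_pageMk 1 π₂ x hx, ← K.pageMk_d 1 (p := p - 1) (n := n - 1) (by simp) (by simp) y hyZ,
      ← ey, ← K.shiftDecPageMk_counitApp x hx, ← ex]
    simp only [Category.assoc, hy]
  obtain ⟨T₃, π₃, _, a, c, ha, hc, e₃⟩ := K.factors_B (m := n - 1) (by lia) _ hxy
  have hx₃ : (K.Z (1 : ℕ) p n).Factors (π₃ ≫ π₂ ≫ x) :=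
    Subobject.factors_of_factors_right _ (Subobject.factors_of_factors_right _ hx)
  have hu : K.shiftDecPageMk ((π₃ ≫ π₂ ≫ x) ≫ K.diff n (n + 1))
      (K.factors_Z_diff _ (p' := p + 1) (by simp) rfl hx₃) = 0 := by
    rw [← K.shiftDecPageMk_d (p := p) (by simp) rfl _ hx₃, ← K.comp_shiftDecPageMk π₃ _
      (Subobject.factors_of_factors_right _ hx), ← K.comp_shiftDecPageMk π₂ _ hx, ← ex]
    simp only [Category.assoc, hx₂, comp_zero]
  obtain ⟨T₄, π₄, _, z, w, hz, hw, e₄⟩ := K.exists_of_shiftDecPageMk_eq_zero rfl _ _ hu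
  have haF := ((K.factors_Z_iff rfl rfl a).1 ha).1
  have hcF : ((K.X (n - 1)).F p).Factors c :=
    K.factors_F_of_le ((K.factors_Z_iff rfl rfl c).1 hc).1 (by lia)
  have hyF := (K.factors_Z_iff (sub_add_cancel n 1) (t := p) (by simp) y).1 hyZ
  have e : π₄ ≫ π₃ ≫ π₂ ≫ x = π₄ ≫ a + (π₄ ≫ (π₃ ≫ y + c)) ≫ K.diff (n - 1) n := by
    rw [Preadditive.comp_sub, sub_eq_iff_eq_add] at e₃
    rw [e₃]
    simp only [Preadditive.comp_add, Preadditive.add_comp, Category.assoc]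
    abel
  have haZ : (K.Z 1 (p + 1) n).Factors (π₄ ≫ a) := by
    refine (K.factors_Z_iff rfl rfl _).2 ⟨Subobject.factors_of_factors_right _ haF, ?_⟩
    have : (π₄ ≫ a) ≫ K.diff n (n + 1) = z + w ≫ K.diff n (n + 1) := by
      have hdd : ((π₄ ≫ (π₃ ≫ y + c)) ≫ K.diff (n - 1) n) ≫ K.diff n (n + 1) = 0 := by
        rw [Category.assoc, K.diff_comp, comp_zero]
      rw [← e₄, ← Category.assoc, e, Preadditive.add_comp, hdd, add_zero]
    rw [this]
    exact factors_add _ ((K.factors_Z_iff rfl rfl z).1 hz).1 ((K.factors_Z_iff rfl rfl w).1 hw).2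
  have hyc : (K.Z (1 : ℕ) (p - 1) (n - 1)).Factors (π₄ ≫ (π₃ ≫ y + c)) := by
    rw [K.factors_Z_iff (sub_add_cancel n 1) (t := p) (by simp)]
    refine ⟨Subobject.factors_of_factors_right _ (factors_add _
      (Subobject.factors_of_factors_right _ hyF.1) (K.factors_F_of_le hcF (by lia))), ?_⟩
    rw [Category.assoc, Preadditive.add_comp, Category.assoc]
    exact Subobject.factors_of_factors_right _ (factors_add _
      (Subobject.factors_of_factors_right _ hyF.2) (K.factors_F_diff le_rfl hcF))
  refine ⟨T₄, π₄ ≫ π₃ ≫ π₂ ≫ π₁, inferInstance,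
    K.shiftDecPageMk _ hyc, ?_⟩
  rw [K.shiftDecPageMk_d (by simp) (by simp)]
  simp only [Category.assoc, ex, comp_shiftDecPageMk]
  refine K.shiftDecPageMk_eq _ _ _ _ ?_
  have e' := sub_eq_iff_eq_add.2 e
  rw [← e'] at haZ
  simpa only [Category.assoc] using haZ

/-- Suppose that `y ∈ Z_1^p` represents a cycle of `E_1(K)`: `d y = u + d v` with `u ∈ F^{p+2}` and
`v ∈ F^{p+1}`. Then `y - v` represents the same class in `E_1(K)`, and it represents a cycle of
`E_1(S (Dec K))` because `d (y - v) = u` lies in `Z_1^{p+2}`. -/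
theorem epi_homologyMap_counitApp (K : FilteredComplex A) (p n : ℤ) :
    Epi (HomologicalComplex.homologyMap (pageMap K.counitApp 1) (p, n)) := by
  rw [HomologicalComplex.epi_homologyMap_iff_up_to_refinements _ (p - 1, n - 1) (p, n)
    (p + 1, n + 1) (page_prev 1 (by simp) (by simp)) (page_next 1 (by simp) rfl)]
  intro T y₂ hy₂
  obtain ⟨T₁, π₁, _, y, hy, ey⟩ := K.exists_pageMk 1 y₂
  have hdy : (K.B (1 : ℕ) (p + 1) (n + 1)).Factors (y ≫ K.diff n (n + 1)) := by
    rw [← K.pageMk_eq_zero_iff 1 _ (K.factors_Z_diff _ (by simp) rfl hy),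
      ← K.pageMk_d 1 (p := p) (by simp) rfl _ hy, ← ey, Category.assoc, hy₂, comp_zero]
  obtain ⟨T₂, π₂, _, u, v, hu, hv, e⟩ := K.factors_B rfl _ hdy
  have huF := ((K.factors_Z_iff rfl rfl u).1 hu).1
  have hvF : ((K.X n).F (p + 1)).Factors v :=
    K.factors_F_of_le ((K.factors_Z_iff rfl rfl v).1 hv).1 (by lia)
  have hyF := Subobject.factors_of_factors_right π₂ ((K.factors_Z_iff rfl rfl y).1 hy).1
  have hd : (π₂ ≫ y - v) ≫ K.diff n (n + 1) = u := by
    rw [Preadditive.sub_comp, Category.assoc, e, add_sub_cancel_right]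
  have hx : (K.Z (1 : ℕ) p n).Factors (π₂ ≫ y - v) := by
    refine (K.factors_Z_iff rfl rfl _).2
      ⟨factors_sub _ hyF (K.factors_F_of_le hvF (by lia)), ?_⟩
    rw [hd]
    exact K.factors_F_of_le huF (by lia)
  have huZ : (K.Z 1 (p + 1 + 1) (n + 1)).Factors u := by
    refine (K.factors_Z_iff rfl rfl _).2 ⟨huF, ?_⟩
    rw [← hd, Category.assoc, K.diff_comp, comp_zero]
    exact Subobject.factors_zero
  refine ⟨T₂, π₂ ≫ π₁, inferInstance, K.shiftDecPageMk _ hx, ?_, 0, ?_⟩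
  · rw [K.shiftDecPageMk_d (p := p) (by simp) rfl]
    have hzero : K.shiftDecPageMk (0 : T₂ ⟶ (K.X (n + 1)).obj)
        (p := p + 1) Subobject.factors_zero = 0 := by
      simpa using (K.comp_shiftDecPageMk (0 : T₂ ⟶ T₂) (0 : T₂ ⟶ (K.X (n + 1)).obj)
        (p := p + 1) Subobject.factors_zero).symm
    rw [← hzero]
    refine K.shiftDecPageMk_eq _ _ _ _ ?_
    rwa [sub_zero, hd]
  · rw [zero_comp, add_zero, K.shiftDecPageMk_counitApp _ hx, Category.assoc, ey,
      comp_pageMk, pageMk_eq_iff, sub_sub_cancel]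
    exact K.factors_B_one_of_F hvF

theorem eQuasiIso_counitApp (K : FilteredComplex A) (r : ℕ) :
    EQuasiIso A (r + 1) K.counitApp := by
  obtain rfl | hr := Nat.eq_zero_or_pos r
  · refine ⟨fun ⟨p, n⟩ => ?_⟩
    have := K.mono_homologyMap_counitApp p n
    have := K.epi_homologyMap_counitApp p n
    rw [quasiIsoAt_iff_isIso_homologyMap]
    exact isIso_of_mono_of_epi
      (HomologicalComplex.homologyMap (pageMap K.counitApp 1) (p, n))
  · exact K.eQuasiIso_counitApp_of_two_le (r + 1) (by lia)

/-- By naturality of `S (Dec K) ⟶ K`, `S (Dec f)` is an `E_{r+1}`-quasi-isomorphism if and only if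
`f` is one. -/
theorem eQuasiIso_dec_iff {K L : FilteredComplex A} (f : K ⟶ L) (r : ℕ) :
    EQuasiIso A r ((decFunctor A).map f) ↔ EQuasiIso A (r + 1) f := by
  rw [← eQuasiIso_shift_iff]
  let g : K.dec.shift ⟶ L.dec.shift := (shiftFunctor A).map ((decFunctor A).map f)
  have h : (pageFunctor A (r + 1)).map g ≫ (pageFunctor A (r + 1)).map L.counitApp =
      (pageFunctor A (r + 1)).map K.counitApp ≫ (pageFunctor A (r + 1)).map f :=
    (Functor.map_comp _ _ _).symm.trans ((congrArg (pageFunctor A (r + 1)).map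
      ((counit A).naturality f)).trans (Functor.map_comp _ _ _))
  have hK : QuasiIso ((pageFunctor A (r + 1)).map K.counitApp) := K.eQuasiIso_counitApp r
  have hL : QuasiIso ((pageFunctor A (r + 1)).map L.counitApp) := L.eQuasiIso_counitApp r
  change QuasiIso ((pageFunctor A (r + 1)).map g) ↔ QuasiIso ((pageFunctor A (r + 1)).map f)
  rw [← quasiIso_iff_comp_right _ ((pageFunctor A (r + 1)).map L.counitApp), h,
    quasiIso_iff_comp_left]

end FilteredComplex

end Counit

/-! ### The equivalence of localized categories -/

section Admissible

variable {A : Type u} [Category.{v} A] [Abelian A]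

namespace FilteredComplex

/-- Every filtered complex is the décalage of its shift: `(Dec (S F))^p K^n` consists of the
`x ∈ F^p K^n` with `d x ∈ F^p K^{n+1}`, a condition which is automatic. The isomorphism is the
identity of the underlying complexes. -/
noncomputable def shiftDecIso (A : Type u) [Category.{v} A] [Abelian A] :
    shiftFunctor A ⋙ decFunctor A ≅ 𝟭 (FilteredComplex A) :=
  have h (K : FilteredComplex A) (n p : ℤ) : (K.shift.dec.X n).F p = (K.X n).F p := by
    change (K.X n).F (p + n - n) ⊓
      preimage (K.diff n (n + 1)) ((K.X (n + 1)).F (p + n + 1 - (n + 1))) = (K.X n).F p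
    have h₁ : p + n + 1 - (n + 1) = p := by lia
    rw [add_sub_cancel_right, h₁, inf_eq_left]
    exact (K.d n (n + 1)).map_le p
  NatIso.ofComponents (fun K => HomologicalComplex.Hom.isoOfComponents (fun n =>
    { hom := ⟨𝟙 (K.X n).obj, fun p => ((h K n p).trans (Subobject.pullback_id _).symm).le⟩
      inv := ⟨𝟙 (K.X n).obj, fun p => ((h K n p).symm.trans (Subobject.pullback_id _).symm).le⟩
      hom_inv_id := FilteredObject.hom_ext (Category.id_comp _)
      inv_hom_id := FilteredObject.hom_ext (Category.id_comp _) })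
    (fun m n _ => FilteredObject.hom_ext
      ((Category.id_comp _).trans (Category.comp_id (K.diff m n)).symm)))
    (fun {K L} f => by
      ext n
      exact (Category.comp_id (f.f n).hom).trans (Category.id_comp _).symm)

theorem shift_filtration (K : FilteredComplex A) (κ : FiltrationType)
    (h : ∀ n, κ.Holds (K.X n)) (n : ℤ) : κ.Holds (K.shift.X n) := by
  have hreg (hr : ∃ q, (K.X n).F q = ⊥) : (K.shift.X n).IsRegular := by
    obtain ⟨q, hq⟩ := hr
    exact ⟨q + n, (congrArg (K.X n).F (add_sub_cancel_right q n)).trans hq⟩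
  cases κ with
  | finite =>
    obtain ⟨⟨a, ha⟩, hb⟩ := h n
    exact ⟨⟨a + n, (congrArg (K.X n).F (add_sub_cancel_right a n)).trans ha⟩, hreg hb⟩
  | regularExhaustive =>
    refine ⟨hreg (h n).1, fun T f => ⟨fun _ _ => le_top, fun U hU => ((h n).2 T f).2 ?_⟩⟩
    rintro _ ⟨p, rfl⟩
    exact (preimage_mono f (congrArg (K.X n).F (add_sub_cancel_right p n)).ge).trans
      (hU ⟨p + n, rfl⟩)

theorem shift_bounded (K : FilteredComplex A) (b : Boundedness) (h : b.Holds K) :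
    b.Holds K.shift := by
  have key (n : ℤ) (hn : IsZero (K.X n)) : IsZero (K.shift.X n) :=
    (FilteredObject.isZero_iff (K.shift.X n)).2 ((FilteredObject.isZero_iff (K.X n)).1 hn)
  cases b with
  | unbounded => trivial
  | below => exact h.imp fun a ha n hn => key n (ha n hn)
  | above => exact h.imp fun a ha n hn => key n (ha n hn)
  | bounded =>
    exact ⟨h.1.imp fun a ha n hn => key n (ha n hn), h.2.imp fun a ha n hn => key n (ha n hn)⟩

end FilteredComplex

variable (A) (κ : FiltrationType) (b : Boundedness)

/-- The functor `S` on the filtered complexes subject to the conditions `κ` and `b`. -/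
def shiftCF : CF A κ b ⥤ CF A κ b :=
  (admissible A κ b).lift ((admissible A κ b).ι ⋙ FilteredComplex.shiftFunctor A)
    fun K => ⟨K.obj.shift_filtration κ K.property.1, K.obj.shift_bounded b K.property.2⟩

/-- The natural transformation `S ∘ Dec ⟶ 𝟭`. -/
noncomputable def counitCF : Dec A κ b ⋙ shiftCF A κ b ⟶ 𝟭 (CF A κ b) where
  app K := ObjectProperty.homMk ((FilteredComplex.counit A).app K.obj)
  naturality _ _ f := ObjectProperty.hom_ext _ ((FilteredComplex.counit A).naturality f.hom)

/-- The isomorphism `Dec ∘ S ≅ 𝟭`. -/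
noncomputable def shiftDecIsoCF : shiftCF A κ b ⋙ Dec A κ b ≅ 𝟭 (CF A κ b) :=
  NatIso.ofComponents
    (fun K => (admissible A κ b).isoMk ((FilteredComplex.shiftDecIso A).app K.obj))
    (fun f => ObjectProperty.hom_ext _
      ((FilteredComplex.shiftDecIso A).hom.naturality f.hom))

theorem E_succ_le_inverseImage_Dec (r : ℕ) :
    E A κ b (r + 1) ≤ (E A κ b r).inverseImage (Dec A κ b) :=
  fun _ _ f hf => (FilteredComplex.eQuasiIso_dec_iff f.hom r).2 hf

theorem E_le_inverseImage_shiftCF (r : ℕ) :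
    E A κ b r ≤ (E A κ b (r + 1)).inverseImage (shiftCF A κ b) :=
  fun _ _ f hf => (FilteredComplex.eQuasiIso_shift_iff f.hom r).2 hf

theorem isEquivalence_derivedDec (r : ℕ)
    (h : E A κ b (r + 1) ≤ (E A κ b r).inverseImage (Dec A κ b)) :
    (derivedDec A κ b r h).IsEquivalence := by
  have hS : (E A κ b r).IsInvertedBy (shiftCF A κ b ⋙ (E A κ b (r + 1)).Q) :=
    fun _ _ f hf => (E A κ b (r + 1)).Q_inverts _ (E_le_inverseImage_shiftCF A κ b r f hf)
  let S' : DF A κ b r ⥤ DF A κ b (r + 1) := Localization.Construction.lift _ hS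
  let eS : (E A κ b r).Q ⋙ S' ≅ shiftCF A κ b ⋙ (E A κ b (r + 1)).Q :=
    eqToIso (Localization.Construction.fac _ _)
  let eD : (E A κ b (r + 1)).Q ⋙ derivedDec A κ b r h ≅ Dec A κ b ⋙ (E A κ b r).Q :=
    eqToIso (Localization.Construction.fac _ _)
  have : Localization.Lifting (E A κ b r).Q (E A κ b r)
      (shiftCF A κ b ⋙ (E A κ b (r + 1)).Q) S' := ⟨eS⟩
  have : Localization.Lifting (E A κ b (r + 1)).Q (E A κ b (r + 1))
      (Dec A κ b ⋙ (E A κ b r).Q) (derivedDec A κ b r h) := ⟨eD⟩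
  have (K : CF A κ b) : IsIso ((Functor.whiskerRight (counitCF A κ b)
      (E A κ b (r + 1)).Q).app K) :=
    (E A κ b (r + 1)).Q_inverts _ (FilteredComplex.eQuasiIso_counitApp K.obj r)
  have := NatIso.isIso_of_isIso_app (Functor.whiskerRight (counitCF A κ b) (E A κ b (r + 1)).Q)
  exact Localization.isEquivalence (E A κ b (r + 1)).Q (E A κ b (r + 1)) (E A κ b r).Q (E A κ b r)
    (Dec A κ b ⋙ (E A κ b r).Q) (derivedDec A κ b r h)
    (shiftCF A κ b ⋙ (E A κ b (r + 1)).Q) S'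
    (Functor.isoWhiskerLeft (Dec A κ b) eS ≪≫
      asIso (Functor.whiskerRight (counitCF A κ b) (E A κ b (r + 1)).Q))
    (Functor.isoWhiskerLeft (shiftCF A κ b) eD ≪≫
      Functor.isoWhiskerRight (shiftDecIsoCF A κ b) (E A κ b r).Q)

end Admissible

end FilteredDecalage

theorem mainTheorem5 {A : Type u} [Category.{v} A] [Abelian A]
    (κ : FilteredDecalage.FiltrationType) (b : FilteredDecalage.Boundedness) (r : ℕ) :
    ∃ h : FilteredDecalage.E A κ b (r + 1) ≤
        (FilteredDecalage.E A κ b r).inverseImage (FilteredDecalage.Dec A κ b),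
      (FilteredDecalage.derivedDec A κ b r h).IsEquivalence :=
  ⟨FilteredDecalage.E_succ_le_inverseImage_Dec A κ b r,
    FilteredDecalage.isEquivalence_derivedDec A κ b r _⟩
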